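/- Let $G=(V,E)$ be a finite simple graph with $n$ vertices, bipartite with respect to a partition $V=W\sqcup B$ (every edge joins $W$ and $B$), and let $k\ge 0$ be an integer. Let $|G\rangle=\big(\prod_{e\in E}CZ_e\big)|+\rangle^{\otimes n}$ be its graph state, which is stabilized by $X_j\prod_{i\in N(j)}Z_i$ for all $j\in V$, where $N(j)$ is the set of neighbours of $j$. Bob sends an arbitrary state (density matrix) $\rho$ of $n(2k+1)$ qubits, arranged in $2k+1$ blocks of $n$ qubits. Alice divides the blocks, uniformly at random, into a first group of $k$ blocks, a second group of $k$ blocks and a third group of one block. In each block of the first group she measures the qubits of $W$ in the $Z$ basis and those of $B$ in the $X$ basis; in each block of the second group she measures the qubits of $B$ in the $Z$ basis and those of $W$ in the $X$ basis. The test is passed if in every measured block the outcome bit $x_j$ of each qubit $j$ measured in the $X$ basis equals the predicted value $\sum_{i\in N(j)}z_i \bmod 2$, where the $z_i$ are the outcome bits of the $Z$ measurements. Let $p(\rho)$ be the probability that the test is passed (over the random division and the measurement outcomes) and, if $p(\rho)>0$, let $\sigma=\sigma(\rho)$ be the state of the third group conditioned on the test being passed (averaged over the division and the outcomes). For $f\in\mathbb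 R$, the significance level of the assertion "$\langle G|\sigma|G\rangle\ge f$" is the supremum of $p(\rho)$ over all $\rho$ with $p(\rho)>0$ for which $\langle G|\sigma(\rho)|G\rangle<f$ (and $0$ if there is no such $\rho$). 1. For every real $\alpha>\frac1{2k+1}$, the assertion $$\langle G|\sigma|G\rangle\ \ge\ 1-\frac{1}{\alpha(2k+1)}$$ has significance level at most $\alpha$; moreover, every $\rho$ with $p(\rho)\ge\alpha$ satisfies this inequality. 2. The lower bound $\frac1{2k+1}$ on $\alpha$ is tight: if $W$ and $B$ are both nonempty, there is an $n$-qubit unit vector $|\psi\rangle$ such that, if Bob sends $2k$ copies of $|G\rangle$ and one copy of $|\psi\rangle$ (in any position), then $p(\rho)=\frac1{2k+1}$ and $\langle G|\sigma|G\rangle=0$. In particular, for every $f>0$ the assertion "$\langle G|\sigma|G\rangle\ge f$" has significance level at least $\frac1{2k+1}$. -/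

import Mathlib

open scoped Matrix ComplexOrder

noncomputable section

namespace GraphStateTest

/-- Computational basis labels of a register with one qubit per element of `V`. -/
abbrev Bits (V : Type*) := V → ZMod 2

/-- Computational basis labels of `2k+1` blocks, each with one qubit per element of `V`. -/
abbrev Blocks (V : Type*) (k : ℕ) := Fin (2 * k + 1) → Bits V

/-- Density matrix. -/
def IsDensity {ι : Type*} [Fintype ι] (ρ : Matrix ι ι ℂ) : Prop :=
  ρ.PosSemidef ∧ ρ.trace = 1

/-- The projector `|ψ⟩⟨ψ|`. -/
def pureState {ι : Type*} (ψ : ι → ℂ) : Matrix ι ι ℂ := Matrix.vecMulVec ψ (star ψ)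

/-- The `Z`-basis vector `|b⟩`. -/
def zKet (b : ZMod 2) : ZMod 2 → ℂ := fun a => if a = b then 1 else 0

/-- The `X`-basis vector `(|0⟩ + (-1)^b |1⟩)/√2`. -/
def xKet (b : ZMod 2) : ZMod 2 → ℂ :=
  fun a => (if a = 1 ∧ b = 1 then -1 else 1) / (Real.sqrt 2 : ℂ)

section Graph

variable {V : Type*} [Fintype V] [DecidableEq V]

/-- The controlled-`Z` gate on the two qubits of `e`: it flips the sign of exactly those
computational basis states in which both qubits are `1`. -/
def cz (e : Sym2 V) : Matrix (Bits V) (Bits V) ℂ :=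
  Matrix.diagonal fun z => if ∀ v ∈ e, z v = 1 then -1 else 1

/-- The state `|+⟩` on every qubit. -/
def plusState : Bits V → ℂ := fun z => ∏ v, xKet 0 (z v)

/-- The graph state `(∏_{e ∈ E} CZ_e) |+⟩^{⊗ V}`. -/
def graphState (G : SimpleGraph V) [DecidableRel G.Adj] : Bits V → ℂ :=
  (G.edgeFinset.noncommProd cz fun _ _ _ _ _ => Matrix.commute_diagonal _ _) *ᵥ plusState

/-- The product vector of the outcome `o` when the qubits in `S` are measured in the `X` basis
and all other qubits in the `Z` basis. -/
def outcomeKet (S : Finset V) (o : Bits V) : Bits V → ℂ :=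
  fun z => ∏ v, if v ∈ S then xKet (o v) (z v) else zKet (o v) (z v)

/-- The `X` outcomes on `S` agree with the values predicted from the `Z` outcomes by the
stabilizers `X_j ⊗ ∏_{i ∈ N(j)} Z_i`, `j ∈ S`. -/
def Consistent (G : SimpleGraph V) [DecidableRel G.Adj] (S : Finset V) (o : Bits V) : Prop :=
  ∀ j ∈ S, o j = ∑ i ∈ G.neighborFinset j, o i

/-- `⟨G|σ|G⟩`. -/
def fidelity (G : SimpleGraph V) [DecidableRel G.Adj] (σ : Matrix (Bits V) (Bits V) ℂ) : ℝ :=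
  (star (graphState G) ⬝ᵥ (σ *ᵥ graphState G)).re

/-- All ways to divide the `2k+1` blocks into a first group of `k` blocks, a second group of `k`
blocks and a single third block. -/
def divisions (k : ℕ) :
    Finset (Finset (Fin (2 * k + 1)) × Finset (Fin (2 * k + 1)) × Fin (2 * k + 1)) :=
  Finset.univ.filter fun d =>
    d.1.card = k ∧ d.2.1.card = k ∧ Disjoint d.1 d.2.1 ∧ d.2.2 ∉ d.1 ∧ d.2.2 ∉ d.2.1

/-- The qubits measured in the `X` basis in block `i`: those of `B` if the block is in the first
group, those of `W` if it is in the second group. -/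
def xSites {k : ℕ} (W B : Finset V) (first : Finset (Fin (2 * k + 1))) (i : Fin (2 * k + 1)) :
    Finset V :=
  if i ∈ first then B else W

/-- The operator `(⨂_{i ≠ third} ⟨o_i|) ⊗ 1_third` belonging to the measurement outcomes `o` on
all blocks other than the third group. -/
def outcomeOp {k : ℕ} (W B : Finset V) (first : Finset (Fin (2 * k + 1)))
    (third : Fin (2 * k + 1)) (o : {i // i ≠ third} → Bits V) :
    Matrix (Bits V) (Blocks V k) ℂ :=
  Matrix.of fun a w =>
    if w third = a then ∏ i : {i // i ≠ third}, star (outcomeKet (xSites W B first i) (o i) (w i))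
    else 0

open Classical in
/-- Unnormalized state of the third group when the test is passed: the average over the uniformly
random division of the sum, over all outcomes that pass the test, of the unnormalized
post-measurement states. -/
def passedState (G : SimpleGraph V) [DecidableRel G.Adj] (W B : Finset V) {k : ℕ}
    (ρ : Matrix (Blocks V k) (Blocks V k) ℂ) : Matrix (Bits V) (Bits V) ℂ :=
  ((divisions k).card : ℂ)⁻¹ • ∑ d ∈ divisions k,
    ∑ o : {i // i ≠ d.2.2} → Bits V with
        ∀ i : {i // i ≠ d.2.2}, Consistent G (xSites W B d.1 i) (o i),
      outcomeOp W B d.1 d.2.2 o * ρ * (outcomeOp W B d.1 d.2.2 o)ᴴ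

/-- The probability that the test is passed. -/
def passProb (G : SimpleGraph V) [DecidableRel G.Adj] (W B : Finset V) {k : ℕ}
    (ρ : Matrix (Blocks V k) (Blocks V k) ℂ) : ℝ :=
  (passedState G W B ρ).trace.re

/-- The state `σ` of the third group conditioned on the test being passed
(meaningful when `passProb` is positive). -/
def resultState (G : SimpleGraph V) [DecidableRel G.Adj] (W B : Finset V) {k : ℕ}
    (ρ : Matrix (Blocks V k) (Blocks V k) ℂ) : Matrix (Bits V) (Bits V) ℂ :=
  ((passProb G W B ρ : ℂ))⁻¹ • passedState G W B ρ

/-- The significance level of the assertion `⟨G|σ|G⟩ ≥ f`: the supremum of the passing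
probabilities over all states whose resulting third-group state violates the assertion. -/
def significanceLevel (G : SimpleGraph V) [DecidableRel G.Adj] (W B : Finset V) (k : ℕ)
    (f : ℝ) : ℝ :=
  sSup {p : ℝ | ∃ ρ : Matrix (Blocks V k) (Blocks V k) ℂ, IsDensity ρ ∧
    p = passProb G W B ρ ∧ 0 < p ∧ fidelity G (resultState G W B ρ) < f}

/-- The product vector with `ψ` in block `i` and the graph state in the other `2k` blocks. -/
def oneWrong (G : SimpleGraph V) [DecidableRel G.Adj] {k : ℕ} (ψ : Bits V → ℂ)
    (i : Fin (2 * k + 1)) : Blocks V k → ℂ :=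
  fun w => ∏ j, if j = i then ψ (w j) else graphState G (w j)

end Graph

end GraphStateTest

end

/-! The vectors `Z^s |G⟩` form an orthonormal basis, and passing the test on a block whose
`X`-measured set is `S` is the projection onto those with `s = 0` on `S`
(`sum_consistent_outcomeKet`). Only the diagonal of `ρ` in the product basis therefore matters:
labels `s` are drawn with probability `weight G ρ s`, and an independent uniform division accepts
them or not (`re_expectation_passedState`).

For a fixed label, call a block good for the first group if it vanishes on `B`, and for the second
if it vanishes on `W`. A nonzero third block is bad for at least one group. Placing the blocks
randomly on a cycle shows that at most a fraction `1/(2k+1)` of the divisions accepts with such a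
third block (`card_divisions_accepted_le`). Hence `p - p⟨G|σ|G⟩ ≤ 1/(2k+1)`, and dividing by `p ≥ α`
gives the bound.

For tightness, the all-ones label in one block is rejected by both groups, so the test is passed
exactly when that block is third. -/

noncomputable section

namespace GraphStateTest

/-! ### Combinatorics of random divisions -/

section Divisions

/-- Labels of divisions: first group, second group, third block. -/
abbrev Division (k : ℕ) :=
  Finset (Fin (2 * k + 1)) × Finset (Fin (2 * k + 1)) × Fin (2 * k + 1)

variable {k : ℕ}

theorem mem_divisions {d : Division k} : d ∈ divisions k ↔
    d.1.card = k ∧ d.2.1.card = k ∧ Disjoint d.1 d.2.1 ∧ d.2.2 ∉ d.1 ∧ d.2.2 ∉ d.2.1 := by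
  simp [divisions]

theorem eq_third_of_notMem {d : Division k} (hd : d ∈ divisions k) {i : Fin (2 * k + 1)}
    (h1 : i ∉ d.1) (h2 : i ∉ d.2.1) : i = d.2.2 := by
  obtain ⟨c1, c2, hdis, t1, t2⟩ := mem_divisions.1 hd
  by_contra hne
  have hc : (insert i (insert d.2.2 (d.1 ∪ d.2.1))).card = 2 * k + 2 := by
    rw [Finset.card_insert_of_notMem (by simp [h1, h2, hne]),
      Finset.card_insert_of_notMem (by simp [t1, t2]), Finset.card_union_of_disjoint hdis]
    omega
  have := Finset.card_le_univ (insert i (insert d.2.2 (d.1 ∪ d.2.1)))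
  rw [hc, Fintype.card_fin] at this
  omega

/-- The action of permutations of the blocks on divisions. -/
def permDivision (π : Equiv.Perm (Fin (2 * k + 1))) (d : Division k) : Division k :=
  (d.1.map π.toEmbedding, d.2.1.map π.toEmbedding, π d.2.2)

theorem permDivision_mem (π : Equiv.Perm (Fin (2 * k + 1))) {d : Division k}
    (hd : d ∈ divisions k) : permDivision π d ∈ divisions k := by
  rw [mem_divisions] at hd ⊢
  simpa [permDivision] using hd

theorem permDivision_mul (π τ : Equiv.Perm (Fin (2 * k + 1))) (d : Division k) :
    permDivision (π * τ) d = permDivision π (permDivision τ d) := by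
  simp only [permDivision, Finset.map_map]
  rfl

theorem permDivision_one (d : Division k) : permDivision 1 d = d := by
  simp [permDivision, Equiv.Perm.one_def]

/-- The group to which a division assigns a block. -/
def groupOf (d : Division k) (i : Fin (2 * k + 1)) : Fin 3 :=
  if i ∈ d.1 then 0 else if i ∈ d.2.1 then 1 else 2

theorem groupOf_eq_zero {d : Division k} {i : Fin (2 * k + 1)} : groupOf d i = 0 ↔ i ∈ d.1 := by
  unfold groupOf; split_ifs <;> simp_all

theorem groupOf_eq_one {d : Division k} (hd : d ∈ divisions k) {i : Fin (2 * k + 1)} :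
    groupOf d i = 1 ↔ i ∈ d.2.1 := by
  have : i ∈ d.1 → i ∉ d.2.1 := fun h => Finset.disjoint_left.1 (mem_divisions.1 hd).2.2.1 h
  unfold groupOf; split_ifs <;> simp_all

theorem groupOf_eq_two {d : Division k} (hd : d ∈ divisions k) {i : Fin (2 * k + 1)} :
    groupOf d i = 2 ↔ i = d.2.2 := by
  have h := @eq_third_of_notMem k d hd i
  obtain ⟨-, -, -, t1, t2⟩ := mem_divisions.1 hd
  constructor
  · intro hi
    unfold groupOf at hi
    split_ifs at hi with h1 h2
    · simp at hi
    · simp at hi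
    · exact h h1 h2
  · rintro rfl
    simp [groupOf, t1, t2]

theorem card_groupOf {d : Division k} (hd : d ∈ divisions k) (c : Fin 3) :
    Fintype.card {i // groupOf d i = c} = if c = 2 then 1 else k := by
  obtain ⟨c1, c2, -⟩ := mem_divisions.1 hd
  rw [Fintype.card_subtype]
  fin_cases c
  · simpa [groupOf_eq_zero] using c1
  · simpa [groupOf_eq_one hd] using c2
  · simp [groupOf_eq_two hd, Finset.filter_eq']

/-- Corresponding groups have equal sizes, so bijections between them glue to a permutation. This
transitivity makes the orbit average uniform. -/
theorem exists_permDivision_eq {d d' : Division k} (hd : d ∈ divisions k)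
    (hd' : d' ∈ divisions k) : ∃ τ, permDivision τ d = d' := by
  have hc : ∀ c, Nonempty ({i // groupOf d i = c} ≃ {i // groupOf d' i = c}) := fun c =>
    ⟨Fintype.equivOfCardEq (by rw [card_groupOf hd, card_groupOf hd'])⟩
  have e := fun c => (hc c).some
  let τ : Equiv.Perm (Fin (2 * k + 1)) :=
    (Equiv.sigmaFiberEquiv (groupOf d)).symm.trans
      ((Equiv.sigmaCongrRight e).trans (Equiv.sigmaFiberEquiv (groupOf d')))
  have hτ : ∀ i, groupOf d' (τ i) = groupOf d i := fun i => (e (groupOf d i) ⟨i, rfl⟩).2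
  have hmem : ∀ i, groupOf d (τ.symm i) = groupOf d' i := fun i => by
    rw [← hτ, Equiv.apply_symm_apply]
  refine ⟨τ, Prod.ext ?_ (Prod.ext ?_ ?_)⟩
  · ext i
    simp [permDivision, Finset.mem_map_equiv, ← groupOf_eq_zero, hmem]
  · ext i
    simp [permDivision, Finset.mem_map_equiv, ← groupOf_eq_one hd, ← groupOf_eq_one hd', hmem]
  · show τ d.2.2 = d'.2.2
    rw [← groupOf_eq_two hd', hτ, groupOf_eq_two hd]

/-- A random permutation of a fixed division is a uniformly random division. -/
theorem card_perm_mul_sum_divisions (f : Division k → ℕ) {d₀ : Division k}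
    (h₀ : d₀ ∈ divisions k) :
    Fintype.card (Equiv.Perm (Fin (2 * k + 1))) * ∑ d ∈ divisions k, f d =
      (divisions k).card * ∑ π, f (permDivision π d₀) := by
  -- Both sides count the double sum of `f (permDivision π d)`: by transitivity the sum over `π`
  -- does not depend on `d`, and each `π` permutes the divisions.
  have h1 : ∀ d ∈ divisions k, ∑ π, f (permDivision π d) = ∑ π, f (permDivision π d₀) := by
    intro d hd
    obtain ⟨τ, rfl⟩ := exists_permDivision_eq h₀ hd
    simp_rw [← permDivision_mul]
    exact Equiv.sum_comp (Equiv.mulRight τ) fun π => f (permDivision π d₀)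
  have h2 : ∀ π : Equiv.Perm (Fin (2 * k + 1)),
      ∑ d ∈ divisions k, f (permDivision π d) = ∑ d ∈ divisions k, f d := fun π =>
    Finset.sum_nbij' (permDivision π) (permDivision π⁻¹)
      (fun d hd => permDivision_mem π hd) (fun d hd => permDivision_mem _ hd)
      (fun d _ => by rw [← permDivision_mul, inv_mul_cancel, permDivision_one])
      (fun d _ => by rw [← permDivision_mul, mul_inv_cancel, permDivision_one])
      (fun _ _ => rfl)
  rw [← smul_eq_mul (divisions k).card, ← Finset.sum_const, ← Finset.sum_congr rfl h1,
    Finset.sum_comm, Finset.sum_congr rfl fun π _ => h2 π]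
  simp

/-- The `k` blocks that follow `p` in the cyclic order. -/
def blocksAfter (p : Fin (2 * k + 1)) : Finset (Fin (2 * k + 1)) :=
  Finset.univ.filter fun i => 1 ≤ (i - p).val ∧ (i - p).val ≤ k

/-- The `k` blocks that precede `p` in the cyclic order. -/
def blocksBefore (p : Fin (2 * k + 1)) : Finset (Fin (2 * k + 1)) :=
  Finset.univ.filter fun i => k + 1 ≤ (i - p).val

theorem card_filter_sub (p : Fin (2 * k + 1)) (a b : ℕ) (hb : b ≤ 2 * k) :
    (Finset.univ.filter fun i : Fin (2 * k + 1) =>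
      a ≤ (i - p).val ∧ (i - p).val ≤ b).card = b + 1 - a := by
  rw [← Nat.card_Icc]
  refine Finset.card_nbij' (fun i => (i - p).val) (fun m => Fin.ofNat _ m + p) ?_ ?_ ?_ ?_
  · intro i hi; simpa using hi
  · intro m hm
    have := Finset.mem_Icc.1 hm
    simp [Nat.mod_eq_of_lt (show m < 2 * k + 1 by omega), this]
  · intro i hi
    simp
  · intro m hm
    have := Finset.mem_Icc.1 hm
    simp [Nat.mod_eq_of_lt (show m < 2 * k + 1 by omega)]

theorem card_blocksAfter (p : Fin (2 * k + 1)) : (blocksAfter p).card = k := by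
  rw [blocksAfter, card_filter_sub p 1 k (by omega)]; omega

theorem card_blocksBefore (p : Fin (2 * k + 1)) : (blocksBefore p).card = k := by
  have h := card_filter_sub p (k + 1) (2 * k) le_rfl
  have e : blocksBefore p = Finset.univ.filter fun i : Fin (2 * k + 1) =>
      k + 1 ≤ (i - p).val ∧ (i - p).val ≤ 2 * k := by
    ext i
    have := (i - p).isLt
    simp only [blocksBefore, Finset.mem_filter, Finset.mem_univ, true_and]
    omega
  rw [e, h]; omega

theorem disjoint_blocksAfter_blocksBefore (p : Fin (2 * k + 1)) :
    Disjoint (blocksAfter p) (blocksBefore p) := by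
  rw [Finset.disjoint_left]
  intro i h1 h2
  simp only [blocksAfter, blocksBefore, Finset.mem_filter, Finset.mem_univ, true_and] at h1 h2
  omega

theorem notMem_blocksAfter (p : Fin (2 * k + 1)) : p ∉ blocksAfter p := by simp [blocksAfter]

theorem notMem_blocksBefore (p : Fin (2 * k + 1)) : p ∉ blocksBefore p := by simp [blocksBefore]

theorem after_mem_divisions (p : Fin (2 * k + 1)) :
    (blocksAfter p, blocksBefore p, p) ∈ divisions k :=
  mem_divisions.2 ⟨card_blocksAfter p, card_blocksBefore p, disjoint_blocksAfter_blocksBefore p,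
    notMem_blocksAfter p, notMem_blocksBefore p⟩

theorem before_mem_divisions (p : Fin (2 * k + 1)) :
    (blocksBefore p, blocksAfter p, p) ∈ divisions k :=
  mem_divisions.2 ⟨card_blocksBefore p, card_blocksAfter p,
    (disjoint_blocksAfter_blocksBefore p).symm, notMem_blocksBefore p, notMem_blocksAfter p⟩

/-- The two cyclic distances are positive and add up to the odd number `2k+1`, so exactly one of
them is at most `k`. -/
theorem mem_after_and_before {p q : Fin (2 * k + 1)} (h : p ≠ q) :
    (q ∈ blocksAfter p ∧ p ∈ blocksBefore q) ∨ (p ∈ blocksAfter q ∧ q ∈ blocksBefore p) := by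
  have hsum : (q - p).val + (p - q).val = 2 * k + 1 ∧ 0 < (q - p).val ∧ 0 < (p - q).val := by
    have hp := p.isLt
    have hq := q.isLt
    rcases lt_or_gt_of_ne h with hlt | hlt
    · have h1 := Fin.coe_sub_iff_le.2 hlt.le
      have h2 := Fin.coe_sub_iff_lt.2 hlt
      have := Fin.lt_def.1 hlt
      omega
    · have h1 := Fin.coe_sub_iff_le.2 hlt.le
      have h2 := Fin.coe_sub_iff_lt.2 hlt
      have := Fin.lt_def.1 hlt
      omega
  simp only [blocksAfter, blocksBefore, Finset.mem_filter, Finset.mem_univ, true_and]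
  omega

theorem divisions_card_pos (k : ℕ) : 0 < (divisions k).card :=
  Finset.card_pos.2 ⟨_, after_mem_divisions 0⟩

/-- For each permutation, exactly one of the `2k+1` cyclic divisions has third block `i`. -/
theorem card_third_eq (i : Fin (2 * k + 1)) :
    (2 * k + 1) * ((divisions k).filter fun d => d.2.2 = i).card = (divisions k).card := by
  have hpos : 0 < Fintype.card (Equiv.Perm (Fin (2 * k + 1))) := Fintype.card_pos
  apply Nat.eq_of_mul_eq_mul_left hpos
  have h : ∀ p : Fin (2 * k + 1), _ := fun p =>
    card_perm_mul_sum_divisions (fun d => if d.2.2 = i then 1 else 0) (after_mem_divisions p)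
  have h' := Finset.sum_congr rfl fun p (_ : p ∈ Finset.univ) => h p
  rw [← Finset.mul_sum Finset.univ _ (divisions k).card, Finset.sum_comm] at h'
  have h1 : ∀ π : Equiv.Perm (Fin (2 * k + 1)), ∑ p, (if (permDivision π
      ((blocksAfter p, blocksBefore p, p) : Division k)).2.2 = i then 1 else 0) = 1 := by
    intro π
    simp [permDivision, ← Equiv.eq_symm_apply]
  rw [Finset.sum_congr rfl fun π _ => h1 π] at h'
  simp only [Finset.sum_const, Finset.card_univ, Fintype.card_fin, smul_eq_mul, mul_one,
    ← Finset.card_filter] at h'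
  linarith

/-- Suppose each block may or may not be accepted as a member of the first group (`P`) and of the
second group (`Q`). Then all blocks are accepted while the third block is not accepted in both
roles for at most a fraction `1/(2k+1)` of all divisions. -/
theorem card_divisions_accepted_le (P Q : Fin (2 * k + 1) → Prop) [DecidablePred P]
    [DecidablePred Q] :
    (2 * k + 1) * ((divisions k).filter fun d =>
      (∀ i ∈ d.1, P i) ∧ (∀ i ∈ d.2.1, Q i) ∧ ¬(P d.2.2 ∧ Q d.2.2)).card ≤ (divisions k).card := by
  have hpos : 0 < Fintype.card (Equiv.Perm (Fin (2 * k + 1))) := Fintype.card_pos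
  apply Nat.le_of_mul_le_mul_left _ hpos
  -- The bad event splits into disjoint cases: `f` if the third block fails `P`, `g` if it fails
  -- only `Q`.
  set f : Division k → ℕ := fun d =>
    if (∀ i ∈ d.1, P i) ∧ (∀ i ∈ d.2.1, Q i) ∧ ¬ P d.2.2 then 1 else 0 with hf
  set g : Division k → ℕ := fun d =>
    if (∀ i ∈ d.1, P i) ∧ (∀ i ∈ d.2.1, Q i) ∧ P d.2.2 ∧ ¬ Q d.2.2 then 1 else 0 with hg
  have hcard : ((divisions k).filter fun d =>
      (∀ i ∈ d.1, P i) ∧ (∀ i ∈ d.2.1, Q i) ∧ ¬(P d.2.2 ∧ Q d.2.2)).card =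
      ∑ d ∈ divisions k, f d + ∑ d ∈ divisions k, g d := by
    rw [← Finset.sum_add_distrib, Finset.card_filter]
    refine Finset.sum_congr rfl fun d _ => ?_
    by_cases h1 : ∀ i ∈ d.1, P i <;> by_cases h2 : ∀ i ∈ d.2.1, Q i <;> by_cases h3 : P d.2.2 <;>
      by_cases h4 : Q d.2.2 <;> simp only [hf, hg, h1, h2, h3, h4] <;> simp
  -- The groups are swapped for `g` but not for `f`. Each orbit average is uniform separately, and
  -- with this choice any two bad positions on the cycle exclude each other.
  have hone : ∀ π : Equiv.Perm (Fin (2 * k + 1)),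
      ∑ p, (f (permDivision π (blocksAfter p, blocksBefore p, p)) +
        g (permDivision π (blocksBefore p, blocksAfter p, p))) ≤ 1 := by
    intro π
    have hsum : ∀ p, f (permDivision π (blocksAfter p, blocksBefore p, p)) +
        g (permDivision π (blocksBefore p, blocksAfter p, p)) =
        if ((∀ i ∈ blocksAfter p, P (π i)) ∧ (∀ i ∈ blocksBefore p, Q (π i)) ∧ ¬ P (π p)) ∨
          ((∀ i ∈ blocksBefore p, P (π i)) ∧ (∀ i ∈ blocksAfter p, Q (π i)) ∧
            P (π p) ∧ ¬ Q (π p)) then 1 else 0 := by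
      intro p
      simp only [hf, hg, permDivision, Finset.forall_mem_map, Equiv.coe_toEmbedding]
      split_ifs <;> first | rfl | tauto
    rw [Finset.sum_congr rfl fun p _ => hsum p, ← Finset.card_filter, Finset.card_le_one]
    intro p hp q hq
    by_contra hne
    simp only [Finset.mem_filter, Finset.mem_univ, true_and] at hp hq
    -- In every case one position asserts, for the other block, the very property that this block
    -- fails.
    rcases mem_after_and_before hne with ⟨h1, h2⟩ | ⟨h1, h2⟩
    · rcases hp with ⟨a, b, c⟩ | ⟨a, b, c, e⟩ <;> rcases hq with ⟨a', b', c'⟩ | ⟨a', b', c', e'⟩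
      · exact c' (a _ h1)
      · exact c (a' _ h2)
      · exact e (b' _ h2)
      · exact e' (b _ h1)
    · rcases hp with ⟨a, b, c⟩ | ⟨a, b, c, e⟩ <;> rcases hq with ⟨a', b', c'⟩ | ⟨a', b', c', e'⟩
      · exact c (a' _ h1)
      · exact e' (b _ h2)
      · exact c' (a _ h2)
      · exact e (b' _ h1)
  have h := Finset.sum_congr rfl fun p (_ : p ∈ (Finset.univ : Finset (Fin (2 * k + 1)))) =>
    congrArg₂ (· + ·) (card_perm_mul_sum_divisions f (after_mem_divisions p))
      (card_perm_mul_sum_divisions g (before_mem_divisions p))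
  simp only [← mul_add, ← Finset.sum_add_distrib] at h
  rw [← Finset.mul_sum Finset.univ _ (divisions k).card, Finset.sum_comm] at h
  simp only [Finset.sum_const, Finset.card_univ, Fintype.card_fin, smul_eq_mul,
    Finset.sum_add_distrib (s := divisions k)] at h
  rw [hcard]
  calc _ = _ := by ring
    _ = _ := h
    _ ≤ (divisions k).card * ∑ π : Equiv.Perm (Fin (2 * k + 1)), 1 :=
        Nat.mul_le_mul_left _ (Finset.sum_le_sum fun π _ => hone π)
    _ = _ := by simp; ring

end Divisions


/-! ### Signs and one-qubit bases -/

section Sign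

/-- The sign `(-1)^a`. -/
def sgn (a : ZMod 2) : ℂ := if a = 1 then -1 else 1

theorem sgn_zero : sgn 0 = 1 := by simp [sgn]

theorem zmod_two_cases (a : ZMod 2) : a = 0 ∨ a = 1 := by
  revert a; decide

theorem sgn_add (a b : ZMod 2) : sgn (a + b) = sgn a * sgn b := by
  rcases zmod_two_cases a with rfl | rfl <;> rcases zmod_two_cases b with rfl | rfl <;>
    simp [sgn, show (1 : ZMod 2) + 1 = 0 from rfl]

theorem sgn_sum {ι : Type*} (s : Finset ι) (f : ι → ZMod 2) :
    sgn (∑ i ∈ s, f i) = ∏ i ∈ s, sgn (f i) := by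
  classical
  induction s using Finset.induction_on with
  | empty => simp [sgn_zero]
  | insert a s ha ih => rw [Finset.sum_insert ha, Finset.prod_insert ha, sgn_add, ih]

theorem star_sgn (a : ZMod 2) : star (sgn a) = sgn a := by
  unfold sgn; split_ifs <;> simp

theorem sum_sgn_mul (a b : ZMod 2) :
    ∑ c : ZMod 2, sgn (c * a) * sgn (c * b) = if a = b then 2 else 0 := by
  have h : ∀ f : ZMod 2 → ℂ, ∑ c, f c = f 0 + f 1 := fun f => Fin.sum_univ_two f
  rw [h]
  rcases zmod_two_cases a with rfl | rfl <;> rcases zmod_two_cases b with rfl | rfl <;>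
    norm_num [sgn]

theorem xKet_apply (a b : ZMod 2) : xKet b a = sgn (a * b) * (Real.sqrt 2 : ℂ)⁻¹ := by
  rcases zmod_two_cases a with rfl | rfl <;> rcases zmod_two_cases b with rfl | rfl <;>
    simp [xKet, sgn, div_eq_mul_inv]

theorem inv_sqrt_two_mul_self : (Real.sqrt 2 : ℂ)⁻¹ * (Real.sqrt 2 : ℂ)⁻¹ = 2⁻¹ := by
  rw [← mul_inv, ← Complex.ofReal_mul, Real.mul_self_sqrt (by norm_num)]
  simp

end Sign

/-! ### The graph basis and the test on one block -/

section GraphBasis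

variable {V : Type*} [Fintype V] [DecidableEq V] (G : SimpleGraph V) [DecidableRel G.Adj]

/-- The sign picked up by the computational basis state `z` under all controlled-`Z` gates. -/
def edgePhase (z : Bits V) : ℂ :=
  ∏ e ∈ G.edgeFinset, if ∀ v ∈ e, z v = 1 then -1 else 1

theorem noncommProd_cz (s : Finset (Sym2 V)) (h) :
    s.noncommProd cz h =
      Matrix.diagonal fun z : Bits V => ∏ e ∈ s, if ∀ v ∈ e, z v = 1 then -1 else 1 := by
  induction s using Finset.induction_on with
  | empty => simp
  | insert e s he ih =>
    rw [Finset.noncommProd_insert_of_notMem _ _ _ _ he, ih, cz, Matrix.diagonal_mul_diagonal]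
    congr 1
    ext z
    rw [Finset.prod_insert he]

theorem graphState_apply (z : Bits V) :
    graphState G z = edgePhase G z * ∏ _v : V, (Real.sqrt 2 : ℂ)⁻¹ := by
  have h : graphState G = _ *ᵥ plusState := congrArg (· *ᵥ plusState) (noncommProd_cz _ _)
  rw [h, Matrix.mulVec_diagonal]
  simp [edgePhase, plusState, xKet_apply, sgn_zero]

theorem star_edgePhase (z : Bits V) : star (edgePhase G z) = edgePhase G z := by
  rw [edgePhase, star_prod]
  refine Finset.prod_congr rfl fun e _ => ?_
  split_ifs <;> simp

theorem edgePhase_mul_self (z : Bits V) : edgePhase G z * edgePhase G z = 1 := by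
  rw [edgePhase, ← Finset.prod_mul_distrib]
  refine Finset.prod_eq_one fun e _ => ?_
  split_ifs <;> simp

-- Each edge has exactly one endpoint in `S`; its phase is charged to that endpoint.
variable {G} in
theorem edgePhase_eq_prod {S : Finset V} (hS : ∀ v w, G.Adj v w → (v ∈ S ↔ w ∉ S))
    (z : Bits V) :
    edgePhase G z = ∏ v, if v ∈ S then sgn (z v * ∑ i ∈ G.neighborFinset v, z i) else 1 := by
  rw [← Finset.prod_filter, Finset.filter_mem_eq_inter, Finset.univ_inter]
  simp_rw [Finset.mul_sum, sgn_sum]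
  rw [Finset.prod_sigma', edgePhase]
  symm
  refine Finset.prod_bij (fun x _ => s(x.1, x.2)) ?_ ?_ ?_ ?_
  · rintro ⟨v, w⟩ h
    simpa using (Finset.mem_sigma.1 h).2
  · rintro ⟨v, w⟩ h ⟨v', w'⟩ h' heq
    simp only [Finset.mem_sigma, SimpleGraph.mem_neighborFinset] at h h'
    rcases Sym2.eq_iff.1 heq with ⟨rfl, rfl⟩ | ⟨rfl, rfl⟩
    · rfl
    · exact absurd h'.1 ((hS _ _ h.2).1 h.1)
  · intro e
    induction e using Sym2.ind with
    | _ v w =>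
      intro he
      have he : G.Adj v w := by simpa using he
      by_cases hv : v ∈ S
      · exact ⟨⟨v, w⟩, by simp [hv, he], rfl⟩
      · exact ⟨⟨w, v⟩, by simp [(hS _ _ he.symm).2 hv, he.symm], Sym2.eq_swap⟩
  · rintro ⟨v, w⟩ h
    simp only [Sym2.mem_iff, forall_eq_or_imp, forall_eq]
    rcases zmod_two_cases (z v) with h1 | h1 <;> rcases zmod_two_cases (z w) with h2 | h2 <;>
      simp [h1, h2, sgn]

/-- The graph basis vector `Z^s |G⟩`. -/
def graphKet (s : Bits V) : Bits V → ℂ := fun z => (∏ v, sgn (s v * z v)) * graphState G z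

theorem graphKet_zero : graphKet G 0 = graphState G := by
  ext z; simp [graphKet, sgn_zero]

/-- The kernel of the projector onto the span of the graph basis vectors `Z^s |G⟩` with `s`
vanishing on `S`. -/
theorem sum_graphKet_mul_star (S : Finset V) (z z' : Bits V) :
    ∑ s : Bits V with ∀ v ∈ S, s v = 0, graphKet G s z * star (graphKet G s z') =
      edgePhase G z * edgePhase G z' *
        ∏ v, if v ∈ S then (2⁻¹ : ℂ) else if z v = z' v then 1 else 0 := by
  -- The allowed labels form a product set, so the sum factorizes into one-qubit character sums.
  have hfil : (Finset.univ.filter fun s : Bits V => ∀ v ∈ S, s v = 0) =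
      Fintype.piFinset fun v => if v ∈ S then {0} else Finset.univ := by
    ext s
    simp only [Finset.mem_filter, Finset.mem_univ, true_and, Fintype.mem_piFinset]
    refine forall_congr' fun v => ?_
    by_cases hv : v ∈ S <;> simp [hv]
  have hterm : ∀ s : Bits V, graphKet G s z * star (graphKet G s z') =
      edgePhase G z * edgePhase G z' * ∏ v, (2⁻¹ * (sgn (s v * z v) * sgn (s v * z' v))) := by
    intro s
    simp only [graphKet, graphState_apply, star_mul', star_prod, star_sgn, star_edgePhase,
      Finset.prod_mul_distrib, ← inv_sqrt_two_mul_self]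
    simp
    ring
  rw [hfil, Finset.sum_congr rfl fun s _ => hterm s, ← Finset.mul_sum,
    ← Finset.prod_univ_sum _ fun v c => (2⁻¹ : ℂ) * (sgn (c * z v) * sgn (c * z' v))]
  congr 1
  refine Finset.prod_congr rfl fun v _ => ?_
  by_cases hv : v ∈ S
  · simp [hv, sgn_zero]
  · simp only [hv, if_false, ← Finset.mul_sum, sum_sgn_mul]
    split_ifs <;> simp

/-- Completeness of the graph basis. -/
theorem sum_graphKet_complete (z z' : Bits V) :
    ∑ s, graphKet G s z * star (graphKet G s z') = if z = z' then 1 else 0 := by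
  have h := sum_graphKet_mul_star G ∅ z z'
  simp only [Finset.notMem_empty, false_imp_iff, implies_true, Finset.filter_true,
    if_false] at h
  rw [h]
  by_cases hz : z = z'
  · subst hz; simp [edgePhase_mul_self]
  · obtain ⟨v, hv⟩ := Function.ne_iff.1 hz
    rw [Finset.prod_eq_zero (Finset.mem_univ v) (by simp [hv])]
    simp [hz]

/-- Orthonormality of the graph basis. -/
theorem star_graphKet_dotProduct (s t : Bits V) :
    star (graphKet G s) ⬝ᵥ graphKet G t = if s = t then 1 else 0 := by
  -- For a square matrix, completeness `U * Uᴴ = 1` already gives orthonormality `Uᴴ * U = 1`.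
  let U : Matrix (Bits V) (Bits V) ℂ := Matrix.of fun z s => graphKet G s z
  have h1 : U * Uᴴ = 1 := by
    ext z z'
    rw [Matrix.mul_apply, Matrix.one_apply]
    exact sum_graphKet_complete G z z'
  have h2 : Uᴴ * U = 1 := mul_eq_one_comm.1 h1
  have h3 := congrFun (congrFun h2 s) t
  rwa [Matrix.mul_apply, Matrix.one_apply] at h3

/-- The outcome of measuring `S` in the `X` basis that is predicted by `Z` outcomes `z`. -/
def predicted (S : Finset V) (z : Bits V) : Bits V :=
  fun v => if v ∈ S then ∑ i ∈ G.neighborFinset v, z i else z v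

variable {G}

/-- Neighbours of `S` lie outside `S`, so if `z` and `z'` agree there, the `X`-basis signs multiply
to the edge phase of `z'`; otherwise both sides vanish. -/
theorem outcomeKet_predicted {S : Finset V} (hS : ∀ v w, G.Adj v w → (v ∈ S ↔ w ∉ S))
    (z z' : Bits V) :
    outcomeKet S (predicted G S z) z' =
      edgePhase G z' *
        ∏ v, if v ∈ S then (Real.sqrt 2 : ℂ)⁻¹ else if z v = z' v then 1 else 0 := by
  rw [outcomeKet]
  by_cases h : ∀ v, v ∉ S → z v = z' v
  · rw [edgePhase_eq_prod hS, ← Finset.prod_mul_distrib]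
    refine Finset.prod_congr rfl fun v _ => ?_
    by_cases hv : v ∈ S
    · have : ∑ i ∈ G.neighborFinset v, z i = ∑ i ∈ G.neighborFinset v, z' i :=
        Finset.sum_congr rfl fun i hi => h i ((hS _ _ (by simpa using hi)).1 hv)
      simp [hv, predicted, xKet_apply, this]
    · simp [hv, predicted, zKet, h v hv]
  · push Not at h
    obtain ⟨v, hv, hne⟩ := h
    rw [Finset.prod_eq_zero (Finset.mem_univ v) (by simp [hv, predicted, zKet, hne.symm]),
      Finset.prod_eq_zero (Finset.mem_univ v) (by simp [hv, hne]), mul_zero]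

theorem consistent_predicted {S : Finset V} (hS : ∀ v w, G.Adj v w → (v ∈ S ↔ w ∉ S))
    (z : Bits V) : Consistent G S (predicted G S z) := by
  intro j hj
  simp only [predicted, hj, if_true]
  refine Finset.sum_congr rfl fun i hi => ?_
  rw [if_neg ((hS _ _ (by simpa using hi)).1 hj)]

/-- A consistent outcome is determined by its `Z` bits, and a nonzero amplitude forces these to be
those of `z`. -/
theorem outcomeKet_eq_zero {S : Finset V} (hS : ∀ v w, G.Adj v w → (v ∈ S ↔ w ∉ S))
    {o z : Bits V} (ho : Consistent G S o) (hne : o ≠ predicted G S z) :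
    outcomeKet S o z = 0 := by
  have h : ∃ v, v ∉ S ∧ z v ≠ o v := by
    by_contra! h
    apply hne
    ext v
    by_cases hv : v ∈ S
    · rw [ho v hv, predicted, if_pos hv]
      exact Finset.sum_congr rfl fun i hi => (h i ((hS _ _ (by simpa using hi)).1 hv)).symm
    · rw [predicted, if_neg hv, h v hv]
  obtain ⟨v, hv, hz⟩ := h
  exact Finset.prod_eq_zero (Finset.mem_univ v) (by simp [hv, zKet, hz])

open Classical in
/-- Passing the test on one block is the projection onto the span of the graph basis vectors
`Z^s |G⟩` with `s` vanishing on the set `S` of qubits measured in the `X` basis. -/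
theorem sum_consistent_outcomeKet {S : Finset V} (hS : ∀ v w, G.Adj v w → (v ∈ S ↔ w ∉ S))
    (z z' : Bits V) :
    ∑ o : Bits V with Consistent G S o, outcomeKet S o z * star (outcomeKet S o z') =
      ∑ s : Bits V with ∀ v ∈ S, s v = 0, graphKet G s z * star (graphKet G s z') := by
  have h := sum_graphKet_mul_star G S z z'
  rw [Finset.sum_eq_single (predicted G S z)]
  · convert h.symm using 1
    rw [outcomeKet_predicted hS, outcomeKet_predicted hS, star_mul', star_edgePhase,
      mul_mul_mul_comm, star_prod, ← Finset.prod_mul_distrib]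
    congr 1
    refine Finset.prod_congr rfl fun v _ => ?_
    split_ifs <;> simp_all [inv_sqrt_two_mul_self]
  · intro o ho hne
    rw [outcomeKet_eq_zero hS (Finset.mem_filter.1 ho).2 hne, zero_mul]
  · intro hn
    exact absurd (Finset.mem_filter.2 ⟨Finset.mem_univ _, consistent_predicted hS z⟩) hn

end GraphBasis


/-! ### From one block to `2k+1` blocks -/

section Blocks

variable {V : Type*} [Fintype V] [DecidableEq V] {k : ℕ}

/-- The operator `(⨂_{i ≠ third} ⟨K_i(o_i)|) ⊗ 1_third` for families `K i` of one-block vectors. -/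
def blockOp (third : Fin (2 * k + 1)) (K : {i // i ≠ third} → Bits V → Bits V → ℂ)
    (o : {i // i ≠ third} → Bits V) : Matrix (Bits V) (Blocks V k) ℂ :=
  Matrix.of fun a w =>
    if w third = a then ∏ i : {i // i ≠ third}, star (K i (o i) (w i)) else 0

theorem sum_blockOp_apply (third : Fin (2 * k + 1))
    (K : {i // i ≠ third} → Bits V → Bits V → ℂ) (C : {i // i ≠ third} → Finset (Bits V))
    (ρ : Matrix (Blocks V k) (Blocks V k) ℂ) (a a' : Bits V) :
    (∑ o ∈ Fintype.piFinset C, blockOp third K o * ρ * (blockOp third K o)ᴴ) a a' =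
      ∑ w', ∑ w, (if w third = a then 1 else 0) * (if w' third = a' then 1 else 0) * ρ w w' *
        ∏ i, ∑ c ∈ C i, K i c (w' i) * star (K i c (w i)) := by
  simp only [Matrix.sum_apply, Matrix.mul_apply, Matrix.conjTranspose_apply, Finset.sum_mul,
    Finset.prod_univ_sum, Finset.mul_sum]
  rw [Finset.sum_comm]
  refine Finset.sum_congr rfl fun w' _ => ?_
  rw [Finset.sum_comm]
  refine Finset.sum_congr rfl fun w _ => Finset.sum_congr rfl fun o _ => ?_
  simp only [blockOp, Matrix.of_apply, Finset.prod_mul_distrib]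
  split_ifs <;> simp [star_prod]
  ring

/-- The sum over outcomes depends only on the projectors built from the vectors `K i c`. -/
theorem sum_blockOp_congr (third : Fin (2 * k + 1))
    (K K' : {i // i ≠ third} → Bits V → Bits V → ℂ) (C C' : {i // i ≠ third} → Finset (Bits V))
    (h : ∀ i z z', ∑ c ∈ C i, K i c z * star (K i c z') = ∑ c ∈ C' i, K' i c z * star (K' i c z'))
    (ρ : Matrix (Blocks V k) (Blocks V k) ℂ) :
    ∑ o ∈ Fintype.piFinset C, blockOp third K o * ρ * (blockOp third K o)ᴴ =
      ∑ o ∈ Fintype.piFinset C', blockOp third K' o * ρ * (blockOp third K' o)ᴴ := by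
  ext a a'
  simp only [sum_blockOp_apply, h]

variable (G : SimpleGraph V) [DecidableRel G.Adj]

/-- The product of the graph basis vectors with labels `s i`. -/
def blocksKet (s : Blocks V k) : Blocks V k → ℂ := fun w => ∏ i, graphKet G (s i) (w i)

theorem sum_blocksKet_complete (w w' : Blocks V k) :
    ∑ s, blocksKet G s w * star (blocksKet G s w') = if w = w' then 1 else 0 := by
  simp only [blocksKet, star_prod, ← Finset.prod_mul_distrib]
  rw [← Fintype.prod_sum fun i (c : Bits V) => graphKet G c (w i) * star (graphKet G c (w' i))]
  simp only [sum_graphKet_complete]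
  by_cases h : w = w'
  · subst h; simp
  · obtain ⟨i, hi⟩ := Function.ne_iff.1 h
    rw [Finset.prod_eq_zero (Finset.mem_univ i) (by simp [hi]), if_neg h]

theorem star_blocksKet_dotProduct (s t : Blocks V k) :
    star (blocksKet G s) ⬝ᵥ blocksKet G t = if s = t then 1 else 0 := by
  have h : star (blocksKet G s) ⬝ᵥ blocksKet G t =
      ∏ i, star (graphKet G (s i)) ⬝ᵥ graphKet G (t i) := by
    simp only [dotProduct, Pi.star_apply, blocksKet, star_prod, ← Finset.prod_mul_distrib]
    rw [← Fintype.prod_sum fun i (c : Bits V) => star (graphKet G (s i) c) * graphKet G (t i) c]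
  rw [h]
  simp only [star_graphKet_dotProduct]
  by_cases h : s = t
  · subst h; simp
  · obtain ⟨i, hi⟩ := Function.ne_iff.1 h
    rw [Finset.prod_eq_zero (Finset.mem_univ i) (by simp [hi]), if_neg h]

/-- Expectation values in a complete family of vectors sum to the trace. -/
theorem sum_expectation_eq_trace {ι : Type*} [Fintype ι] [DecidableEq ι] (K : ι → ι → ℂ)
    (hK : ∀ w w', ∑ s, K s w * star (K s w') = if w = w' then 1 else 0) (M : Matrix ι ι ℂ) :
    ∑ s, star (K s) ⬝ᵥ (M *ᵥ K s) = M.trace := by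
  have h : ∀ s, star (K s) ⬝ᵥ (M *ᵥ K s) = ∑ w, ∑ w', M w w' * (K s w' * star (K s w)) := by
    intro s
    simp only [dotProduct, Matrix.mulVec, Finset.mul_sum, Pi.star_apply]
    refine Finset.sum_congr rfl fun w _ => Finset.sum_congr rfl fun w' _ => ?_
    ring
  simp only [h]
  rw [Finset.sum_comm]
  simp only [Matrix.trace, Matrix.diag]
  refine Finset.sum_congr rfl fun w _ => ?_
  rw [Finset.sum_comm]
  simp only [← Finset.mul_sum, hK]
  simp

theorem blockOp_conjTranspose_mulVec (third : Fin (2 * k + 1)) (s : Blocks V k) :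
    (blockOp third (fun _ => graphKet G) fun i => s i)ᴴ *ᵥ graphKet G (s third) =
      blocksKet G s := by
  ext w
  simp only [Matrix.mulVec, dotProduct, Matrix.conjTranspose_apply, blockOp, Matrix.of_apply,
    apply_ite star, star_prod, star_star, star_zero, ite_mul, zero_mul, Finset.sum_ite_eq,
    Finset.mem_univ, if_true, blocksKet]
  rw [Fintype.prod_eq_mul_prod_subtype_ne _ third, mul_comm]

theorem dotProduct_conj_mulVec {m n : Type*} [Fintype m] [Fintype n] (O : Matrix m n ℂ)
    (ρ : Matrix n n ℂ) (φ : m → ℂ) :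
    star φ ⬝ᵥ ((O * ρ * Oᴴ) *ᵥ φ) = star (Oᴴ *ᵥ φ) ⬝ᵥ (ρ *ᵥ (Oᴴ *ᵥ φ)) := by
  rw [Matrix.star_mulVec, Matrix.conjTranspose_conjTranspose, ← Matrix.mulVec_mulVec,
    ← Matrix.mulVec_mulVec, Matrix.dotProduct_mulVec, Matrix.dotProduct_mulVec]

/-- The label `s` of a product of graph basis vectors is accepted by the division `d`. -/
def Accepted (W B : Finset V) (d : Division k) (s : Blocks V k) : Prop :=
  ∀ i, i ≠ d.2.2 → ∀ v ∈ xSites W B d.1 i, s i v = 0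

-- Outcome vectors may be replaced by graph basis vectors, because block by block they sum to the
-- same projector. Each resulting term is an expectation of `ρ` in one product basis vector.
open Classical in
theorem expectation_passed_division {W B : Finset V}
    (hW : ∀ v w, G.Adj v w → (v ∈ W ↔ w ∉ W)) (hB : ∀ v w, G.Adj v w → (v ∈ B ↔ w ∉ B))
    (d : Division k) (ρ : Matrix (Blocks V k) (Blocks V k) ℂ) (t : Bits V) :
    star (graphKet G t) ⬝ᵥ ((∑ o : {i // i ≠ d.2.2} → Bits V with
        ∀ i : {i // i ≠ d.2.2}, Consistent G (xSites W B d.1 i) (o i),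
      outcomeOp W B d.1 d.2.2 o * ρ * (outcomeOp W B d.1 d.2.2 o)ᴴ) *ᵥ graphKet G t) =
    ∑ s : Blocks V k with s d.2.2 = t ∧ Accepted W B d s,
      star (blocksKet G s) ⬝ᵥ (ρ *ᵥ blocksKet G s) := by
  have hS : ∀ i v w, G.Adj v w → (v ∈ xSites W B d.1 i ↔ w ∉ xSites W B d.1 i) := by
    intro i
    unfold xSites
    split_ifs
    exacts [hB, hW]
  have h1 : (Finset.univ.filter fun o : {i // i ≠ d.2.2} → Bits V =>
      ∀ i : {i // i ≠ d.2.2}, Consistent G (xSites W B d.1 i) (o i)) =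
      Fintype.piFinset fun i : {i // i ≠ d.2.2} =>
        Finset.univ.filter fun o => Consistent G (xSites W B d.1 i) o := by
    ext o; simp
  have h2 := sum_blockOp_congr d.2.2 (fun i => outcomeKet (xSites W B d.1 i))
    (fun _ => graphKet G) (fun i => Finset.univ.filter fun o => Consistent G (xSites W B d.1 i) o)
    (fun i => Finset.univ.filter fun s => ∀ v ∈ xSites W B d.1 i, s v = 0)
    (fun i z z' => (sum_consistent_outcomeKet (hS i) z z').trans (by congr!)) ρ
  rw [h1]
  refine (congrArg (fun M => star (graphKet G t) ⬝ᵥ (M *ᵥ graphKet G t)) h2).trans ?_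
  rw [Matrix.sum_mulVec, dotProduct_sum]
  symm
  -- A label with third block `t` corresponds to its restriction to the measured blocks.
  refine Finset.sum_bij' (fun s _ i => s i)
    (fun o _ => (Equiv.funSplitAt d.2.2 (Bits V)).symm (t, o)) ?_ ?_ ?_ ?_ ?_
  · intro s hs
    obtain ⟨-, -, hs⟩ := Finset.mem_filter.1 hs
    simpa [Accepted] using hs
  · intro o ho
    refine Finset.mem_filter.2 ⟨Finset.mem_univ _, by simp, fun i hi => ?_⟩
    simp only [Fintype.mem_piFinset, Finset.mem_filter, Finset.mem_univ, true_and] at ho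
    simpa [hi] using ho ⟨i, hi⟩
  · intro s hs
    obtain ⟨-, rfl, -⟩ := Finset.mem_filter.1 hs
    exact (Equiv.funSplitAt d.2.2 (Bits V)).symm_apply_apply s
  · intro o ho
    exact congrArg Prod.snd ((Equiv.funSplitAt d.2.2 (Bits V)).apply_symm_apply (t, o))
  · intro s hs
    obtain ⟨-, rfl, -⟩ := Finset.mem_filter.1 hs
    rw [dotProduct_conj_mulVec, blockOp_conjTranspose_mulVec]

end Blocks


/-! ### The test as a classical experiment on labels -/

section Test

variable {V : Type*} [Fintype V] [DecidableEq V] {k : ℕ} (G : SimpleGraph V) [DecidableRel G.Adj]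

/-- The weight of `ρ` on the product of graph basis vectors with label `s`. -/
def weight (ρ : Matrix (Blocks V k) (Blocks V k) ℂ) (s : Blocks V k) : ℝ :=
  (star (blocksKet G s) ⬝ᵥ (ρ *ᵥ blocksKet G s)).re

theorem weight_nonneg {ρ : Matrix (Blocks V k) (Blocks V k) ℂ} (hρ : IsDensity ρ)
    (s : Blocks V k) : 0 ≤ weight G ρ s :=
  (Complex.le_def.1 (hρ.1.dotProduct_mulVec_nonneg (blocksKet G s))).1

theorem sum_weight {ρ : Matrix (Blocks V k) (Blocks V k) ℂ} (hρ : IsDensity ρ) :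
    ∑ s, weight G ρ s = 1 := by
  simp only [weight]
  rw [← Complex.re_sum, sum_expectation_eq_trace (blocksKet G) (sum_blocksKet_complete G), hρ.2,
    Complex.one_re]

theorem weight_pureState (s t : Blocks V k) :
    weight G (pureState (blocksKet G t)) s = if s = t then 1 else 0 := by
  have h := star_blocksKet_dotProduct G (k := k)
  rw [weight, pureState, Matrix.vecMulVec_mulVec, h t s, dotProduct_smul, h s t]
  by_cases hst : s = t
  · simp [hst]
  · simp [hst]

theorem isDensity_pureState_blocksKet (s : Blocks V k) :
    IsDensity (pureState (blocksKet G s)) := by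
  refine ⟨Matrix.posSemidef_vecMulVec_self_star _, ?_⟩
  rw [pureState, Matrix.trace_vecMulVec, dotProduct_comm, star_blocksKet_dotProduct, if_pos rfl]

variable {G} {W B : Finset V}

open Classical in
theorem re_expectation_passedState (hW : ∀ v w, G.Adj v w → (v ∈ W ↔ w ∉ W))
    (hB : ∀ v w, G.Adj v w → (v ∈ B ↔ w ∉ B)) (ρ : Matrix (Blocks V k) (Blocks V k) ℂ)
    (t : Bits V) :
    (star (graphKet G t) ⬝ᵥ (passedState G W B ρ *ᵥ graphKet G t)).re =
      ∑ s, weight G ρ s * (((divisions k).filter fun d =>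
        s d.2.2 = t ∧ Accepted W B d s).card / (divisions k).card) := by
  have h : (star (graphKet G t) ⬝ᵥ (passedState G W B ρ *ᵥ graphKet G t)) =
      (((divisions k).card : ℝ)⁻¹ : ℝ) * ∑ d ∈ divisions k,
        ∑ s : Blocks V k with s d.2.2 = t ∧ Accepted W B d s,
          star (blocksKet G s) ⬝ᵥ (ρ *ᵥ blocksKet G s) := by
    rw [passedState, Matrix.smul_mulVec, dotProduct_smul, Matrix.sum_mulVec, dotProduct_sum,
      Finset.sum_congr rfl fun d _ => expectation_passed_division G hW hB d ρ t]
    simp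
  rw [h, Complex.re_ofReal_mul]
  simp only [Complex.re_sum]
  simp only [Finset.card_filter, Nat.cast_sum, Finset.sum_filter, Finset.sum_div, Finset.mul_sum]
  rw [Finset.sum_comm]
  refine Finset.sum_congr rfl fun s _ => Finset.sum_congr rfl fun d _ => ?_
  split_ifs
  · simp only [weight, Nat.cast_one]; ring
  · simp

open Classical in
theorem fidelity_passedState (hW : ∀ v w, G.Adj v w → (v ∈ W ↔ w ∉ W))
    (hB : ∀ v w, G.Adj v w → (v ∈ B ↔ w ∉ B)) (ρ : Matrix (Blocks V k) (Blocks V k) ℂ) :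
    fidelity G (passedState G W B ρ) =
      ∑ s, weight G ρ s * (((divisions k).filter fun d =>
        s d.2.2 = 0 ∧ Accepted W B d s).card / (divisions k).card) := by
  rw [← re_expectation_passedState hW hB, graphKet_zero, fidelity]

-- The trace is taken in the graph basis; the values of the third label partition the accepting
-- divisions.
open Classical in
theorem passProb_eq (hW : ∀ v w, G.Adj v w → (v ∈ W ↔ w ∉ W))
    (hB : ∀ v w, G.Adj v w → (v ∈ B ↔ w ∉ B)) (ρ : Matrix (Blocks V k) (Blocks V k) ℂ) :
    passProb G W B ρ =
      ∑ s, weight G ρ s * (((divisions k).filter fun d =>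
        Accepted W B d s).card / (divisions k).card) := by
  rw [passProb, ← sum_expectation_eq_trace (graphKet G) (sum_graphKet_complete G), Complex.re_sum,
    Finset.sum_congr rfl fun t _ => re_expectation_passedState hW hB ρ t, Finset.sum_comm]
  refine Finset.sum_congr rfl fun s _ => ?_
  rw [← Finset.mul_sum, ← Finset.sum_div, ← Nat.cast_sum]
  congr 3
  rw [Finset.card_eq_sum_card_fiberwise (f := fun d => s d.2.2) (t := Finset.univ) (by simp)]
  refine Finset.sum_congr rfl fun t _ => ?_
  rw [Finset.filter_filter]
  congr 1
  ext d
  simp [and_comm]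

theorem fidelity_smul (c : ℝ) (σ : Matrix (Bits V) (Bits V) ℂ) :
    fidelity G ((c : ℂ) • σ) = c * fidelity G σ := by
  rw [fidelity, Matrix.smul_mulVec, dotProduct_smul, smul_eq_mul, Complex.re_ofReal_mul, fidelity]

theorem fidelity_resultState (ρ : Matrix (Blocks V k) (Blocks V k) ℂ) :
    fidelity G (resultState G W B ρ) =
      (passProb G W B ρ)⁻¹ * fidelity G (passedState G W B ρ) := by
  rw [resultState, ← Complex.ofReal_inv, fidelity_smul]

-- As `W` and `B` cover all qubits, a nonzero third label fails to vanish on one of them, which is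
-- the situation of `card_divisions_accepted_le`.
open Classical in
theorem card_accepted_nonzero_le (hWB : W ∪ B = Finset.univ) (s : Blocks V k) :
    (2 * k + 1) * ((divisions k).filter fun d => s d.2.2 ≠ 0 ∧ Accepted W B d s).card ≤
      (divisions k).card := by
  refine le_trans (Nat.mul_le_mul_left _ (Finset.card_le_card fun d hd => ?_))
    (card_divisions_accepted_le (fun i => ∀ v ∈ B, s i v = 0) fun i => ∀ v ∈ W, s i v = 0)
  obtain ⟨hd, hne, hacc⟩ := Finset.mem_filter.1 hd
  obtain ⟨-, -, hdis, t1, t2⟩ := mem_divisions.1 hd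
  refine Finset.mem_filter.2 ⟨hd, fun i hi => ?_, fun i hi => ?_, fun ⟨h1, h2⟩ => hne ?_⟩
  · have := hacc i (by rintro rfl; exact t1 hi)
    rwa [xSites, if_pos hi] at this
  · have := hacc i (by rintro rfl; exact t2 hi)
    rwa [xSites, if_neg (Finset.disjoint_right.1 hdis hi)] at this
  · ext v
    rcases Finset.mem_union.1 (hWB ▸ Finset.mem_univ v) with hv | hv
    exacts [h2 v hv, h1 v hv]

/-- The test is passed with a third block orthogonal to the graph state with probability at most
`1/(2k+1)`. -/
theorem passProb_sub_fidelity_le (hW : ∀ v w, G.Adj v w → (v ∈ W ↔ w ∉ W))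
    (hB : ∀ v w, G.Adj v w → (v ∈ B ↔ w ∉ B)) (hWB : W ∪ B = Finset.univ)
    {ρ : Matrix (Blocks V k) (Blocks V k) ℂ} (hρ : IsDensity ρ) :
    passProb G W B ρ - fidelity G (passedState G W B ρ) ≤ 1 / (2 * (k : ℝ) + 1) := by
  classical
  rw [passProb_eq hW hB, fidelity_passedState hW hB, ← Finset.sum_sub_distrib]
  have hk : (0 : ℝ) < 2 * (k : ℝ) + 1 := by positivity
  have hD : (0 : ℝ) < (divisions k).card := by exact_mod_cast divisions_card_pos k
  calc _ ≤ ∑ s, weight G ρ s * (1 / (2 * (k : ℝ) + 1)) := by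
        refine Finset.sum_le_sum fun s _ => ?_
        rw [← mul_sub]
        refine mul_le_mul_of_nonneg_left ?_ (weight_nonneg G hρ s)
        rw [← sub_div, div_le_div_iff₀ hD hk, one_mul]
        have h1 := Finset.card_filter_add_card_filter_not
          (s := (divisions k).filter fun d => Accepted W B d s) (fun d => s d.2.2 = 0)
        have h2 := card_accepted_nonzero_le hWB s
        rw [Finset.filter_filter, Finset.filter_filter] at h1
        simp only [and_comm (b := _ = _), and_comm (b := ¬ _ = _)] at h1
        have h1' : (((divisions k).filter fun d => s d.2.2 = 0 ∧ Accepted W B d s).card : ℝ) +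
          ((divisions k).filter fun d => s d.2.2 ≠ 0 ∧ Accepted W B d s).card =
          ((divisions k).filter fun d => Accepted W B d s).card := by exact_mod_cast h1
        have h2' : (2 * (k : ℝ) + 1) * ((divisions k).filter fun d =>
          s d.2.2 ≠ 0 ∧ Accepted W B d s).card ≤ (divisions k).card := by exact_mod_cast h2
        rw [← h1', add_sub_cancel_left]
        linarith
    _ = 1 / (2 * (k : ℝ) + 1) := by rw [← Finset.sum_mul, sum_weight G hρ, one_mul]

/-- Supplies the upper bound without which the supremum in `significanceLevel` could not be bounded
below. -/
theorem passProb_le_one (hW : ∀ v w, G.Adj v w → (v ∈ W ↔ w ∉ W))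
    (hB : ∀ v w, G.Adj v w → (v ∈ B ↔ w ∉ B))
    {ρ : Matrix (Blocks V k) (Blocks V k) ℂ} (hρ : IsDensity ρ) : passProb G W B ρ ≤ 1 := by
  classical
  rw [passProb_eq hW hB, ← sum_weight G hρ]
  refine Finset.sum_le_sum fun s _ => mul_le_of_le_one_right (weight_nonneg G hρ s) ?_
  exact div_le_one_of_le₀ (by exact_mod_cast Finset.card_filter_le _ _) (by positivity)

/-- The label of `Z^{⊗ V} |G⟩` in block `i` and of the graph state in the other blocks. -/
def wrongLabel (V : Type*) (i : Fin (2 * k + 1)) : Blocks V k := fun j _ => if j = i then 1 else 0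

theorem oneWrong_eq_blocksKet (i : Fin (2 * k + 1)) :
    oneWrong G (graphKet G fun _ => 1) i = blocksKet G (wrongLabel V i) := by
  ext w
  refine Finset.prod_congr rfl fun j _ => ?_
  by_cases h : j = i
  · rw [if_pos h]
    congr 1
    ext v
    simp [wrongLabel, h]
  · rw [if_neg h, ← graphKet_zero]
    congr 1
    ext v
    simp [wrongLabel, h]

/-- If block `i` is measured, some qubit of it is measured in the `X` basis, and there the label is
`1`. -/
theorem accepted_wrongLabel (hW : W.Nonempty) (hB : B.Nonempty) (d : Division k)
    (i : Fin (2 * k + 1)) : Accepted W B d (wrongLabel V i) ↔ d.2.2 = i := by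
  constructor
  · intro h
    by_contra hne
    have hS : (xSites W B d.1 i).Nonempty := by
      unfold xSites
      split_ifs
      exacts [hB, hW]
    obtain ⟨v, hv⟩ := hS
    simpa [wrongLabel] using h i (Ne.symm hne) v hv
  · rintro rfl j hj v -
    simp [wrongLabel, hj]

theorem passProb_wrongLabel (hW : ∀ v w, G.Adj v w → (v ∈ W ↔ w ∉ W))
    (hB : ∀ v w, G.Adj v w → (v ∈ B ↔ w ∉ B)) (hW' : W.Nonempty) (hB' : B.Nonempty)
    (i : Fin (2 * k + 1)) :
    passProb G W B (pureState (blocksKet G (wrongLabel V i))) = 1 / (2 * (k : ℝ) + 1) := by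
  classical
  have hk : (0 : ℝ) < 2 * (k : ℝ) + 1 := by positivity
  have hD : (0 : ℝ) < (divisions k).card := by exact_mod_cast divisions_card_pos k
  have h : (2 * (k : ℝ) + 1) * ((divisions k).filter fun d => d.2.2 = i).card =
      (divisions k).card := by exact_mod_cast card_third_eq i
  rw [passProb_eq hW hB]
  simp only [weight_pureState, ite_mul, one_mul, zero_mul, Finset.sum_ite_eq', Finset.mem_univ,
    if_true, accepted_wrongLabel hW' hB']
  rw [div_eq_div_iff hD.ne' hk.ne']
  linarith

theorem fidelity_passedState_wrongLabel (hW : ∀ v w, G.Adj v w → (v ∈ W ↔ w ∉ W))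
    (hB : ∀ v w, G.Adj v w → (v ∈ B ↔ w ∉ B)) (hW' : W.Nonempty) (hB' : B.Nonempty)
    (i : Fin (2 * k + 1)) :
    fidelity G (passedState G W B (pureState (blocksKet G (wrongLabel V i)))) = 0 := by
  classical
  rw [fidelity_passedState hW hB]
  simp only [weight_pureState, ite_mul, one_mul, zero_mul, Finset.sum_ite_eq', Finset.mem_univ,
    if_true, accepted_wrongLabel hW' hB']
  rw [Finset.filter_false_of_mem, Finset.card_empty, Nat.cast_zero, zero_div]
  rintro d - ⟨h, rfl⟩
  obtain ⟨v, -⟩ := hW'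
  simpa [wrongLabel] using congrFun h v

end Test

end GraphStateTest

end

/-! ### The significance bound and its tightness -/

open GraphStateTest in
theorem theorem1 {V : Type*} [Fintype V] [DecidableEq V] (G : SimpleGraph V) [DecidableRel G.Adj]
    (W B : Finset V) (hG : G.IsBipartiteWith (W : Set V) (B : Set V))
    (hWB : W ∪ B = Finset.univ) (k : ℕ) :
    (∀ α : ℝ, 1 / (2 * (k : ℝ) + 1) < α →
      significanceLevel G W B k (1 - 1 / (α * (2 * (k : ℝ) + 1))) ≤ α ∧
      ∀ ρ : Matrix (Blocks V k) (Blocks V k) ℂ, IsDensity ρ → α ≤ passProb G W B ρ →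
        1 - 1 / (α * (2 * (k : ℝ) + 1)) ≤ fidelity G (resultState G W B ρ)) ∧
    (W.Nonempty → B.Nonempty →
      (∃ ψ : Bits V → ℂ, star ψ ⬝ᵥ ψ = 1 ∧ ∀ i : Fin (2 * k + 1),
        IsDensity (pureState (oneWrong G ψ i)) ∧
        passProb G W B (pureState (oneWrong G ψ i)) = 1 / (2 * (k : ℝ) + 1) ∧
        fidelity G (resultState G W B (pureState (oneWrong G ψ i))) = 0) ∧
      ∀ f : ℝ, 0 < f → 1 / (2 * (k : ℝ) + 1) ≤ significanceLevel G W B k f) := by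
  have hdis : ∀ v, v ∈ W → v ∉ B := fun v h h' =>
    Set.disjoint_left.1 hG.disjoint (Finset.mem_coe.2 h) (Finset.mem_coe.2 h')
  have hadj : ∀ v w, G.Adj v w → v ∈ W ∧ w ∈ B ∨ v ∈ B ∧ w ∈ W := fun v w h => by
    simpa using hG.mem_of_adj h
  -- The lemmas use bipartiteness in this form: every edge has exactly one endpoint in `W`, and
  -- exactly one in `B`.
  have hW : ∀ v w, G.Adj v w → (v ∈ W ↔ w ∉ W) := fun v w h => by
    have := hadj v w h; have := hdis v; have := hdis w; tauto
  have hB : ∀ v w, G.Adj v w → (v ∈ B ↔ w ∉ B) := fun v w h => by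
    have := hadj v w h; have := hdis v; have := hdis w; tauto
  have hk : (0 : ℝ) < 2 * (k : ℝ) + 1 := by positivity
  constructor
  · intro α hα
    have hα0 : 0 < α := lt_trans (by positivity) hα
    have key : ∀ ρ : Matrix (Blocks V k) (Blocks V k) ℂ, IsDensity ρ → α ≤ passProb G W B ρ →
        1 - 1 / (α * (2 * (k : ℝ) + 1)) ≤ fidelity G (resultState G W B ρ) := by
      intro ρ hρ hp
      have hp0 := hα0.trans_le hp
      have h := passProb_sub_fidelity_le hW hB hWB hρ
      rw [fidelity_resultState, inv_mul_eq_div, le_div_iff₀ hp0]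
      have h3 : 1 / (2 * (k : ℝ) + 1) ≤ 1 / (α * (2 * (k : ℝ) + 1)) * passProb G W B ρ := by
        rw [one_div_mul_eq_div, div_le_div_iff₀ hk (by positivity)]
        nlinarith
      linarith
    -- Nonnegativity of `α` covers the empty set, whose supremum is `0`.
    refine ⟨Real.sSup_le ?_ hα0.le, key⟩
    rintro p ⟨ρ, hρ, rfl, -, hf⟩
    by_contra hp
    exact absurd (key ρ hρ (not_le.1 hp).le) (not_le.2 hf)
  · intro hW' hB'
    have hfid : ∀ i : Fin (2 * k + 1), fidelity G (resultState G W B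
        (pureState (blocksKet G (wrongLabel V i)))) = 0 := fun i => by
      rw [fidelity_resultState, fidelity_passedState_wrongLabel hW hB hW' hB', mul_zero]
    -- The witness is `Z^{⊗ V} |G⟩`, whose label vanishes nowhere on `W` or `B`.
    refine ⟨⟨graphKet G fun _ => 1, by rw [star_graphKet_dotProduct, if_pos rfl], fun i => ?_⟩,
      fun f hf => ?_⟩
    · rw [oneWrong_eq_blocksKet]
      exact ⟨isDensity_pureState_blocksKet G _, passProb_wrongLabel hW hB hW' hB' i, hfid i⟩
    · refine le_csSup ⟨1, ?_⟩ ⟨pureState (blocksKet G (wrongLabel V 0)),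
        isDensity_pureState_blocksKet G _, (passProb_wrongLabel hW hB hW' hB' 0).symm,
        by positivity, by rwa [hfid]⟩
      rintro p ⟨ρ, hρ, rfl, -⟩
      exact passProb_le_one hW hB hρ
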